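/- Let $(\Omega,\mathcal A,\mu)$ be a complete measure space with the direct sum property: every measurable set of non-zero measure contains a measurable set of finite non-zero measure, and every subset of the Boolean algebra $\mathcal A/\!\sim$ of measurable sets modulo null sets has a least upper bound. Let $L^1$, $L^\infty$ and $L^1+L^\infty$ denote the corresponding spaces of (classes of) real-valued measurable functions on $\Omega$. Let $T:L^1\to L^1$ be an absolute contraction, that is, a linear operator with $\|Tf\|_1\le\|f\|_1$ for all $f\in L^1$ and $\|Tf\|_\infty\le\|f\|_\infty$ for all $f\in L^1\cap L^\infty$. Then there exists a unique linear operator $S:L^1+L^\infty\to L^1+L^\infty$ such that (a) $S$ is a Dunford–Schwartz operator, that is, $\|Sf\|_1\le\|f\|_1$ for all $f\in L^1$ and $\|Sf\|_\infty\le\|f\|_\infty$ for all $f\in L^\infty$; (b) $Sf=Tf$ for all $f\in L^1$; and (c) the restriction $S|_{L^\infty}:L^\infty\to L^\infty$ is continuous with respect to the topology $\sigma(L^\infty,L^1)$, the coarsest topology on $L^\infty$ for which $f\mapsto\int fg\,d\mu$ is continuous for every $g\in L^1$. -/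

import Mathlib

open MeasureTheory Set
open scoped ENNReal Topology

/-- Equality almost everywhere, as an equivalence relation on the measurable sets. -/
def aeEqSetoid {Ω : Type*} [MeasurableSpace Ω] (μ : Measure Ω) :
    Setoid {s : Set Ω // MeasurableSet s} where
  r s t := (s : Set Ω) =ᵐ[μ] (t : Set Ω)
  iseqv := ⟨fun _ => Filter.EventuallyEq.rfl, fun h => h.symm, fun h h' => h.trans h'⟩

/-- The Boolean algebra `𝒜 / ∼` of equivalence classes of measurable sets modulo null sets. -/
def MeasureAlgebra {Ω : Type*} [MeasurableSpace Ω] (μ : Measure Ω) : Type _ :=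
  Quotient (aeEqSetoid μ)

/-- The order of the measure algebra: inclusion up to a null set. -/
instance MeasureAlgebra.instPartialOrder {Ω : Type*} [MeasurableSpace Ω] (μ : Measure Ω) :
    PartialOrder (MeasureAlgebra μ) where
  le a b := Quotient.liftOn₂ a b (fun s t => (s : Set Ω) ≤ᵐ[μ] (t : Set Ω))
    (fun _ _ _ _ hs ht => propext
      ⟨fun h => (hs.symm.le.trans h).trans ht.le, fun h => (hs.le.trans h).trans ht.symm.le⟩)
  le_refl a := Quotient.inductionOn a fun _ => Filter.EventuallyLE.rfl
  le_trans a b c := Quotient.inductionOn₃ a b c fun _ _ _ h h' => Filter.EventuallyLE.trans h h'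
  le_antisymm a b := Quotient.inductionOn₂ a b fun _ _ h h' =>
    Quotient.sound (Filter.EventuallyLE.antisymm h h')

/-- Every measurable set of non-zero measure has a measurable subset of finite non-zero measure. -/
def IsSemifiniteMeasure {Ω : Type*} [MeasurableSpace Ω] (μ : Measure Ω) : Prop :=
  ∀ s : Set Ω, MeasurableSet s → μ s ≠ 0 →
    ∃ t ⊆ s, MeasurableSet t ∧ μ t ≠ 0 ∧ μ t < ∞

/-- The direct sum property: the measure is semifinite, and every subset of the Boolean algebra
of measurable sets modulo null sets has a least upper bound. -/
structure HasDirectSumProperty {Ω : Type*} [MeasurableSpace Ω] (μ : Measure Ω) : Prop where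
  semifinite : IsSemifiniteMeasure μ
  exists_isLUB : ∀ C : Set (MeasureAlgebra μ), ∃ a : MeasureAlgebra μ, IsLUB C a

/-- The space `L¹ + L^∞` of real functions, inside the space of all (classes of) almost everywhere
finite real measurable functions. -/
noncomputable def L1AddLinf {Ω : Type*} [MeasurableSpace Ω] (μ : Measure Ω) :
    Submodule ℝ (Ω →ₘ[μ] ℝ) :=
  Lp.LpSubmodule ℝ ℝ 1 μ ⊔ Lp.LpSubmodule ℝ ℝ ∞ μ

/-- The inclusion of `L¹` in `L¹ + L^∞`. -/
noncomputable def inclL1 {Ω : Type*} [MeasurableSpace Ω] {μ : Measure Ω} (f : Lp ℝ 1 μ) :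
    L1AddLinf μ :=
  ⟨(f : Ω →ₘ[μ] ℝ), Submodule.mem_sup_left f.2⟩

/-- The inclusion of `L^∞` in `L¹ + L^∞`. -/
noncomputable def inclLinf {Ω : Type*} [MeasurableSpace Ω] {μ : Measure Ω} (f : Lp ℝ ∞ μ) :
    L1AddLinf μ :=
  ⟨(f : Ω →ₘ[μ] ℝ), Submodule.mem_sup_right f.2⟩

/-- The `L^p` norm, with values in `[0, ∞]`, of an element of `L¹ + L^∞`; it is finite
exactly on the elements that lie in `L^p`. -/
noncomputable def normL1AddLinf {Ω : Type*} [MeasurableSpace Ω] {μ : Measure Ω} (p : ℝ≥0∞)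
    (f : L1AddLinf μ) : ℝ≥0∞ :=
  eLpNorm (f : Ω →ₘ[μ] ℝ) p μ

/-- Dunford–Schwartz operators: linear operators of `L¹ + L^∞` that contract the `L¹` norm on `L¹`
and the `L^∞` norm on `L^∞`. -/
structure IsDunfordSchwartz {Ω : Type*} [MeasurableSpace Ω] {μ : Measure Ω}
    (S : L1AddLinf μ →ₗ[ℝ] L1AddLinf μ) : Prop where
  norm_one_le : ∀ f : Lp ℝ 1 μ, normL1AddLinf 1 (S (inclL1 f)) ≤ normL1AddLinf 1 (inclL1 f)
  norm_top_le : ∀ f : Lp ℝ ∞ μ, normL1AddLinf ∞ (S (inclLinf f)) ≤ normL1AddLinf ∞ (inclLinf f)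

/-- Absolute contractions: linear operators of `L¹` that contract the `L¹` norm, and contract the
`L^∞` norm on `L¹ ∩ L^∞`. -/
structure IsAbsoluteContraction {Ω : Type*} [MeasurableSpace Ω] {μ : Measure Ω}
    (T : Lp ℝ 1 μ →ₗ[ℝ] Lp ℝ 1 μ) : Prop where
  norm_one_le : ∀ f : Lp ℝ 1 μ, ‖T f‖ ≤ ‖f‖
  norm_top_le : ∀ f : Lp ℝ 1 μ, (f : Ω →ₘ[μ] ℝ) ∈ Lp ℝ ∞ μ →
    eLpNorm (T f) ∞ μ ≤ eLpNorm f ∞ μ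

/-- The topology `σ(L^∞, L¹)` on `L^∞`: the coarsest one for which all the functionals
`f ↦ ∫ f g dμ`, with `g` in `L¹`, are continuous. -/
@[reducible] noncomputable def sigmaTopology {Ω : Type*} [MeasurableSpace Ω] (μ : Measure Ω) :
    TopologicalSpace (Lp ℝ ∞ μ) :=
  TopologicalSpace.induced (fun (f : Lp ℝ ∞ μ) (g : Lp ℝ 1 μ) => ∫ x, f x * g x ∂μ)
    Pi.topologicalSpace

/-- The operator `S` of `L¹ + L^∞` maps `L^∞` to itself, and its restriction `R` to `L^∞` is
continuous from `σ(L^∞, L¹)` to `σ(L^∞, L¹)`. -/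
def IsSigmaContinuousOnLinf {Ω : Type*} [MeasurableSpace Ω] {μ : Measure Ω}
    (S : L1AddLinf μ →ₗ[ℝ] L1AddLinf μ) : Prop :=
  ∃ R : Lp ℝ ∞ μ → Lp ℝ ∞ μ, (∀ f : Lp ℝ ∞ μ, S (inclLinf f) = inclLinf (R f)) ∧
    Continuous[sigmaTopology μ, sigmaTopology μ] R

/-! On `L^∞` the operator has to be a second adjoint. The direct sum property makes `L^∞` the dual
of `L¹` (`HasDirectSumProperty.exists_linfPairing_eq`), so `T` has an adjoint `T*` on `L^∞`. Since
`T` contracts the `L^∞` norm, duality shows that `T*` contracts the `L¹` norm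
(`HasDirectSumProperty.eLpNorm_one_l1Adjoint_le`). By density of `L¹ ∩ L^∞` in `L¹`, it therefore
induces a contraction `T'` of `L¹`. The adjoint of `T'` contracts `L^∞` and, like every adjoint, is
`σ(L^∞, L¹)`-continuous. It agrees with `T` on `L¹ ∩ L^∞`, because `∫_A T'* h = ∫ h T*χ_A = ∫_A T h`
when `μ A < ∞`. Hence the two operators glue to `S` on `L¹ + L^∞`.

For uniqueness, `f χ_A` tends to `f` in `σ(L^∞, L¹)` as `A` grows through the sets of finite
measure, and the pairing separates points by semifiniteness. A continuous operator of `L^∞` is thus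
determined by its values on `L¹ ∩ L^∞`.

The duality is local at first: on a set of finite measure, the Riesz theorem in `L²` gives a
density. These densities form a possibly uncountable family, which least upper bounds in the measure
algebra glue together. -/

section

variable {Ω : Type*} [MeasurableSpace Ω] {μ : Measure Ω}

/-! ### Gluing through least upper bounds in the measure algebra. -/

/-- The class of a measurable set in the measure algebra. -/
def MeasureAlgebra.mk (μ : Measure Ω) (s : Set Ω) (hs : MeasurableSet s) : MeasureAlgebra μ :=
  Quotient.mk (aeEqSetoid μ) ⟨s, hs⟩

theorem MeasureAlgebra.mk_le_mk {s t : Set Ω} {hs : MeasurableSet s} {ht : MeasurableSet t} :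
    MeasureAlgebra.mk μ s hs ≤ MeasureAlgebra.mk μ t ht ↔ s ≤ᵐ[μ] t :=
  Iff.rfl

/-- In a measure space with the direct sum property, a family of measurable subsets `V i ⊆ A i`
that is compatible up to null sets is glued to one measurable set. -/
theorem HasDirectSumProperty.exists_measurableSet_inter_ae_eq (hμ : HasDirectSumProperty μ)
    {ι : Type*} {A V : ι → Set Ω} (hA : ∀ i, MeasurableSet (A i)) (hV : ∀ i, MeasurableSet (V i))
    (hVA : ∀ i, V i ⊆ A i) (h : ∀ i j, (V j ∩ A i : Set Ω) ≤ᵐ[μ] V i) :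
    ∃ U : Set Ω, MeasurableSet U ∧ ∀ i, (U ∩ A i : Set Ω) =ᵐ[μ] V i := by
  obtain ⟨a, ha⟩ := hμ.exists_isLUB (range fun i => MeasureAlgebra.mk μ (V i) (hV i))
  obtain ⟨U, hU, rfl⟩ : ∃ U hU, a = MeasureAlgebra.mk μ U hU :=
    Quotient.inductionOn a fun U => ⟨U.1, U.2, rfl⟩
  have hle : ∀ i, V i ≤ᵐ[μ] U := fun i => MeasureAlgebra.mk_le_mk.1 (ha.1 ⟨i, rfl⟩)
  refine ⟨U, hU, fun i => ?_⟩
  -- Removing `A i \ V i` from `U` leaves an upper bound, by compatibility; minimality of `U` then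
  -- makes the removed part null.
  have hub' : MeasureAlgebra.mk μ (U \ (A i \ V i)) (hU.diff ((hA i).diff (hV i))) ∈
      upperBounds (range fun i => MeasureAlgebra.mk μ (V i) (hV i)) := by
    rintro _ ⟨j, rfl⟩
    refine MeasureAlgebra.mk_le_mk.2 ?_
    filter_upwards [hle j, h i j] with x hx hx' hj
    exact ⟨hx hj, fun hn => hn.2 (hx' ⟨hj, hn.1⟩)⟩
  have hub : (U : Set Ω) ≤ᵐ[μ] (U \ (A i \ V i) : Set Ω) :=
    MeasureAlgebra.mk_le_mk.1 (ha.2 hub')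
  refine Filter.EventuallyLE.antisymm ?_ ?_
  · filter_upwards [hub] with x hx hUA
    by_contra hn
    exact (hx hUA.1).2 ⟨hUA.2, hn⟩
  · filter_upwards [hle i] with x hx hVi
    exact ⟨hx hVi, hVA i hVi⟩

/-- In a measure space with the direct sum property, a family of measurable functions `g i` on
measurable sets `A i` that is compatible up to null sets is glued to one measurable function. -/
theorem HasDirectSumProperty.exists_measurable_ae_eq_restrict (hμ : HasDirectSumProperty μ)
    {ι : Type*} {A : ι → Set Ω} {g : ι → Ω → ℝ} (hA : ∀ i, MeasurableSet (A i))
    (hg : ∀ i, Measurable (g i)) (h : ∀ i j, ∀ᵐ x ∂μ, x ∈ A i → x ∈ A j → g i x = g j x) :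
    ∃ u : Ω → ℝ, Measurable u ∧ ∀ i, ∀ᵐ x ∂μ, x ∈ A i → u x = g i x := by
  -- A function is encoded by its countably many superlevel sets at rational levels, and each level
  -- is glued separately.
  have key : ∀ q : ℚ, ∃ U : Set Ω, MeasurableSet U ∧
      ∀ i, (U ∩ A i : Set Ω) =ᵐ[μ] (A i ∩ {x | (q : ℝ) < g i x} : Set Ω) := by
    intro q
    refine hμ.exists_measurableSet_inter_ae_eq hA
      (fun i => (hA i).inter (measurableSet_lt measurable_const (hg i)))
      (fun i => inter_subset_left) fun i j => ?_
    filter_upwards [h i j] with x hx hx'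
    refine ⟨hx'.2, ?_⟩
    have := hx'.1.2
    simp only [mem_ofPred_eq] at this ⊢
    rwa [hx hx'.2 hx'.1.1]
  choose U hU hUA using key
  classical
  -- The supremum of the levels `q` with `x ∈ U q` is taken after `exp`, in `[0, ∞]`: there it
  -- always exists, and the value `0` off `U q` does not affect it. The logarithm undoes `exp`.
  refine ⟨fun x => (⨆ q : ℚ, (U q).indicator (fun _ => ENNReal.ofReal (Real.exp q)) x).toReal.log,
    ?_, fun i => ?_⟩
  · exact (Measurable.iSup fun q => measurable_const.indicator (hU q)).ennreal_toReal.log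
  have hall : ∀ᵐ x ∂μ, ∀ q : ℚ, (x ∈ U q ∩ A i) ↔ x ∈ A i ∩ {x | (q : ℝ) < g i x} :=
    ae_all_iff.2 fun q => (hUA q i).mem_iff
  filter_upwards [hall] with x hx hxA
  have hmem : ∀ q : ℚ, x ∈ U q ↔ (q : ℝ) < g i x := fun q => by
    simpa [hxA] using hx q
  have hsup : (⨆ q : ℚ, (U q).indicator (fun _ => ENNReal.ofReal (Real.exp q)) x) =
      ENNReal.ofReal (Real.exp (g i x)) := by
    refine le_antisymm (iSup_le fun q => ?_) (le_of_forall_lt fun c hc => ?_)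
    · by_cases hq : x ∈ U q
      · rw [indicator_of_mem hq]
        exact ENNReal.ofReal_le_ofReal (Real.exp_le_exp.2 ((hmem q).1 hq).le)
      · simp [hq]
    · have hlim : Filter.Tendsto (fun y : ℝ => ENNReal.ofReal (Real.exp y)) (𝓝[<] (g i x))
          (𝓝 (ENNReal.ofReal (Real.exp (g i x)))) :=
        ((ENNReal.continuous_ofReal.comp Real.continuous_exp).tendsto _).mono_left
          nhdsWithin_le_nhds
      obtain ⟨l, hl, hl'⟩ := (mem_nhdsLT_iff_exists_Ioo_subset).1 (hlim (lt_mem_nhds hc))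
      obtain ⟨q, hq, hq'⟩ := exists_rat_btwn (mem_Iio.1 hl)
      have h1 : c < ENNReal.ofReal (Real.exp q) := hl' ⟨hq, hq'⟩
      refine h1.trans_le (le_iSup_of_le q ?_)
      rw [indicator_of_mem ((hmem q).2 hq')]
  rw [hsup, ENNReal.toReal_ofReal (Real.exp_pos _).le, Real.log_exp]

/-! ### Semifinite measures. -/

/-- In a semifinite measure space, a bound for the integrals over the sets of finite measure is
a bound for the integral. -/
theorem IsSemifiniteMeasure.lintegral_le_of_forall_setLIntegral_le (hμ : IsSemifiniteMeasure μ)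
    {u : Ω → ℝ≥0∞} (hu : Measurable u) {C : ℝ≥0∞}
    (h : ∀ A, MeasurableSet A → μ A < ∞ → ∫⁻ x in A, u x ∂μ ≤ C) : ∫⁻ x, u x ∂μ ≤ C := by
  rcases eq_or_ne C ∞ with rfl | hC
  · exact le_top
  set ν := μ.withDensity u
  have hν : ∀ A, MeasurableSet A → ν A = ∫⁻ x in A, u x ∂μ := fun A hA => withDensity_apply u hA
  set F : Set (Set Ω) := {A | MeasurableSet A ∧ μ A < ∞}
  set s : ℝ≥0∞ := sSup (ν '' F)
  have hsC : s ≤ C := sSup_le <| by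
    rintro _ ⟨A, hA, rfl⟩
    rw [hν A hA.1]
    exact h A hA.1 hA.2
  -- `F` is stable under finite unions, so continuity from below bounds countable unions, although
  -- these may have infinite `μ`-measure.
  have hacc : ∀ A : ℕ → Set Ω, (∀ n, A n ∈ F) → ν (⋃ n, A n) ≤ s := by
    intro A hA
    rw [measure_iUnion_eq_iSup_accumulate]
    refine iSup_le fun n => le_sSup ⟨_, ⟨?_, ?_⟩, rfl⟩
    · rw [accumulate_def]
      exact MeasurableSet.biUnion (to_countable _) fun i _ => (hA i).1
    · rw [accumulate_def]
      exact measure_biUnion_lt_top (finite_Iic n) fun i _ => (hA i).2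
  obtain ⟨w, -, hw, hwF⟩ := exists_seq_tendsto_sSup
    (S := ν '' F) ⟨_, ∅, ⟨MeasurableSet.empty, by simp⟩, rfl⟩ (OrderTop.bddAbove _)
  choose A hAF hAw using hwF
  have hBm : MeasurableSet (⋃ n, A n) := MeasurableSet.iUnion fun n => (hAF n).1
  have hB : s ≤ ν (⋃ n, A n) :=
    le_of_tendsto' hw fun n => (hAw n).symm.le.trans (measure_mono (subset_iUnion A n))
  -- The union already attains the finite supremum `s`. A set `t` of finite non-zero measure outside
  -- it, on which `u` does not vanish, could be added to every `A n` and would push the supremum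
  -- beyond `s`.
  have hzero : μ ({x | u x ≠ 0} \ ⋃ n, A n) = 0 := by
    by_contra hne
    have hm : MeasurableSet {x | u x ≠ 0} := hu (measurableSet_singleton 0).compl
    obtain ⟨t, ht, htm, ht0, htfin⟩ := hμ _ (hm.diff hBm) hne
    have h1 := hacc (fun n => A n ∪ t) fun n =>
      ⟨(hAF n).1.union htm, measure_union_lt_top (hAF n).2 htfin⟩
    rw [← iUnion_union, measure_union (disjoint_left.2 fun x hx hx' => (ht hx').2 hx) htm] at h1
    have h2 : ν t = 0 := by
      by_contra hpos
      exact absurd (h1.trans hB) (not_le.2 (ENNReal.lt_add_right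
        (ne_top_of_le_ne_top hC ((hacc A hAF).trans hsC)) hpos))
    rw [hν t htm, setLIntegral_eq_zero_iff htm hu] at h2
    refine ht0 (measure_mono_null (fun x hx => ?_) (ae_iff.1 h2))
    exact fun hn => (ht hx).1 (hn hx)
  have hcompl : ν (⋃ n, A n)ᶜ = 0 := by
    rw [hν _ hBm.compl, setLIntegral_eq_zero_iff hBm.compl hu, ae_iff]
    refine measure_mono_null (fun x hx => ?_) hzero
    simp only [mem_ofPred_eq, Classical.not_imp] at hx
    exact ⟨hx.2, hx.1⟩
  calc ∫⁻ x, u x ∂μ = ν univ := by rw [hν _ MeasurableSet.univ, Measure.restrict_univ]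
    _ = ν (⋃ n, A n) := by rw [← measure_add_measure_compl hBm, hcompl, add_zero]
    _ ≤ C := (hacc A hAF).trans hsC

/-- In a semifinite measure space, a function that vanishes almost everywhere on every set of
finite measure vanishes almost everywhere. -/
theorem IsSemifiniteMeasure.ae_of_forall_ae_restrict (hμ : IsSemifiniteMeasure μ)
    {p : Ω → Prop} (hp : MeasurableSet {x | p x})
    (h : ∀ A, MeasurableSet A → μ A < ∞ → ∀ᵐ x ∂μ.restrict A, p x) : ∀ᵐ x ∂μ, p x := by
  by_contra hne
  obtain ⟨t, ht, htm, ht0, htfin⟩ := hμ _ hp.compl hne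
  refine ht0 ?_
  refine measure_mono_null (fun x hx => ?_)
    (ae_iff.1 ((ae_restrict_iff' htm).1 (h t htm htfin)))
  exact fun hn => ht hx (hn hx)

/-! ### The duality between `L¹` and `L^∞`. -/

/-- The duality pairing `(h, f) ↦ ∫ h f dμ` between `L^∞` and `L¹`. -/
noncomputable def linfPairing (μ : Measure Ω) : Lp ℝ ∞ μ →L[ℝ] Lp ℝ 1 μ →L[ℝ] ℝ :=
  (ContinuousLinearMap.mul ℝ ℝ).lpPairing μ ∞ 1

theorem linfPairing_apply (h : Lp ℝ ∞ μ) (f : Lp ℝ 1 μ) :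
    linfPairing μ h f = ∫ x, h x * f x ∂μ := by
  simp [linfPairing, ContinuousLinearMap.lpPairing_eq_integral]

theorem linfPairing_indicatorConstLp (h : Lp ℝ ∞ μ) {A : Set Ω} (hA : MeasurableSet A)
    (hμA : μ A ≠ ∞) : linfPairing μ h (indicatorConstLp 1 hA hμA 1) = ∫ x in A, h x ∂μ := by
  rw [linfPairing_apply, ← integral_indicator hA]
  refine integral_congr_ae ?_
  filter_upwards [indicatorConstLp_coeFn (p := 1) (hs := hA) (hμs := hμA) (c := (1 : ℝ))] with x hx
  rw [hx]
  by_cases hxA : x ∈ A <;> simp [hxA]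

theorem integrableOn_of_linf (h : Lp ℝ ∞ μ) {A : Set Ω} (hμA : μ A < ∞) :
    IntegrableOn h A μ := by
  have : IsFiniteMeasure (μ.restrict A) := ⟨by simpa using hμA⟩
  exact ((Lp.memLp h).restrict A).integrable le_top

theorem norm_indicatorConstLp_one_one {A : Set Ω} (hA : MeasurableSet A) (hμA : μ A ≠ ∞) :
    ‖(indicatorConstLp 1 hA hμA (1 : ℝ) : Lp ℝ 1 μ)‖ = μ.real A := by
  rw [norm_indicatorConstLp one_ne_zero ENNReal.one_ne_top]
  simp

/-- Continuous functionals on `L¹` that agree on the indicators of sets of finite measure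
are equal. -/
theorem dual_l1_ext {φ ψ : Lp ℝ 1 μ →L[ℝ] ℝ}
    (h : ∀ A (hA : MeasurableSet A) (hμA : μ A ≠ ∞),
      φ (indicatorConstLp 1 hA hμA 1) = ψ (indicatorConstLp 1 hA hμA 1)) : φ = ψ := by
  ext f
  induction f using Lp.induction ENNReal.one_ne_top with
  | indicatorConst c hs hμs =>
    have : (indicatorConstLp 1 hs hμs.ne c : Lp ℝ 1 μ) = c • indicatorConstLp 1 hs hμs.ne 1 := by
      refine Lp.ext ?_
      filter_upwards [indicatorConstLp_coeFn (p := 1) (hs := hs) (hμs := hμs.ne) (c := c),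
        indicatorConstLp_coeFn (p := 1) (hs := hs) (hμs := hμs.ne) (c := (1 : ℝ)),
        Lp.coeFn_smul c (indicatorConstLp 1 hs hμs.ne (1 : ℝ) : Lp ℝ 1 μ)] with x h1 h2 h3
      rw [h1, h3, Pi.smul_apply, h2]
      simp [indicator]
    rw [Lp.simpleFunc.coe_indicatorConst, this, map_smul, map_smul, h]
  | add f g _ hf hg => rw [map_add, map_add, hf, hg]
  | isClosed => exact isClosed_eq φ.continuous ψ.continuous

/-- In a semifinite measure space, functions with the same integrals over the sets of finite
measure are equal almost everywhere. -/
theorem IsSemifiniteMeasure.ae_eq_of_forall_setIntegral_eq (hμ : IsSemifiniteMeasure μ)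
    {u v : Ω → ℝ} (hu : AEStronglyMeasurable u μ) (hv : AEStronglyMeasurable v μ)
    (hui : ∀ A, MeasurableSet A → μ A < ∞ → IntegrableOn u A μ)
    (hvi : ∀ A, MeasurableSet A → μ A < ∞ → IntegrableOn v A μ)
    (h : ∀ A, MeasurableSet A → μ A < ∞ → ∫ x in A, u x ∂μ = ∫ x in A, v x ∂μ) : u =ᵐ[μ] v := by
  have := hμ.ae_of_forall_ae_restrict (p := fun x => hu.mk u x = hv.mk v x)
    (measurableSet_eq_fun hu.stronglyMeasurable_mk.measurable
      hv.stronglyMeasurable_mk.measurable) fun A hA hμA => by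
    filter_upwards [ae_eq_restrict_of_forall_setIntegral_eq hui hvi h hA hμA.ne,
      ae_restrict_of_ae hu.ae_eq_mk, ae_restrict_of_ae hv.ae_eq_mk] with x h1 h2 h3
    rw [← h2, h1, h3]
  filter_upwards [hu.ae_eq_mk, hv.ae_eq_mk, this] with x h1 h2 h3
  rw [h1, h2, h3]

/-- Testing against indicators of sets of finite measure suffices; without semifiniteness, a
non-null set could carry no non-zero element of `L¹`. -/
theorem linfPairing_injective (hμ : IsSemifiniteMeasure μ) :
    Function.Injective (linfPairing μ) := fun h h' hh =>
  Lp.ext <| hμ.ae_eq_of_forall_setIntegral_eq (Lp.aestronglyMeasurable h)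
    (Lp.aestronglyMeasurable h') (fun _ _ hA => integrableOn_of_linf h hA)
    (fun _ _ hA => integrableOn_of_linf h' hA) fun A hA hμA => by
      rw [← linfPairing_indicatorConstLp h hA hμA.ne, ← linfPairing_indicatorConstLp h' hA hμA.ne,
        hh]

/-- A continuous functional on `L¹` is represented, on the subsets of a set of finite measure,
by a function. -/
theorem exists_setIntegral_eq_dual_l1 (φ : Lp ℝ 1 μ →L[ℝ] ℝ) {A : Set Ω}
    (hA : MeasurableSet A) (hμA : μ A ≠ ∞) :
    ∃ g : Ω → ℝ, Measurable g ∧ (∀ᵐ x ∂μ, x ∈ A → |g x| ≤ ‖φ‖) ∧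
      ∀ B (hB : MeasurableSet B) (hμB : μ B ≠ ∞), B ⊆ A →
        ∫ x in B, g x ∂μ = φ (indicatorConstLp 1 hB hμB 1) := by
  set a : Lp ℝ 2 μ := indicatorConstLp 2 hA hμA 1
  -- Multiplication by `χ_A` maps `L²` into `L¹` by Hölder, so `φ` pulls back to a functional on a
  -- Hilbert space.
  set ψ : Lp ℝ 2 μ →L[ℝ] ℝ := φ ∘L ((ContinuousLinearMap.mul ℝ ℝ).holderL μ 2 2 1 a)
  set g₀ : Lp ℝ 2 μ := (InnerProductSpace.toDual ℝ (Lp ℝ 2 μ)).symm ψ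
  have hmk := (Lp.aestronglyMeasurable g₀).ae_eq_mk
  set g : Ω → ℝ := (Lp.aestronglyMeasurable g₀).mk g₀
  have hgm : Measurable g := (Lp.aestronglyMeasurable g₀).stronglyMeasurable_mk.measurable
  have hrep : ∀ B (hB : MeasurableSet B) (hμB : μ B ≠ ∞), B ⊆ A →
      ∫ x in B, g x ∂μ = φ (indicatorConstLp 1 hB hμB 1) := by
    intro B hB hμB hBA
    have h1 : ψ (indicatorConstLp 2 hB hμB 1) = ∫ x in B, g₀ x ∂μ := by
      rw [← L2.inner_indicatorConstLp_one (𝕜 := ℝ) hB hμB g₀, real_inner_comm,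
        ← InnerProductSpace.toDual_apply_apply (𝕜 := ℝ), LinearIsometryEquiv.apply_symm_apply]
    rw [← integral_congr_ae (ae_restrict_of_ae hmk), ← h1]
    change φ _ = _
    congr 1
    refine Lp.ext ?_
    refine (ContinuousLinearMap.coeFn_holder (ContinuousLinearMap.mul ℝ ℝ) a
      (indicatorConstLp 2 hB hμB 1)).trans ?_
    filter_upwards [indicatorConstLp_coeFn (p := 2) (hs := hA) (hμs := hμA) (c := (1 : ℝ)),
      indicatorConstLp_coeFn (p := 2) (hs := hB) (hμs := hμB) (c := (1 : ℝ)),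
      indicatorConstLp_coeFn (p := 1) (hs := hB) (hμs := hμB) (c := (1 : ℝ))] with x h2 h3 h4
    rw [h2, h3, h4]
    by_cases hx : x ∈ B
    · simp [hx, hBA hx]
    · simp [hx]
  refine ⟨g, hgm, ?_, hrep⟩
  have hfin : IsFiniteMeasure (μ.restrict A) := ⟨by simpa using hμA.lt_top⟩
  have hgA : IntegrableOn g A μ :=
    (((Lp.memLp g₀).restrict A).integrable (by norm_num)).congr (ae_restrict_of_ae hmk)
  -- This is `|φ(χ_B)| ≤ ‖φ‖ μ(B)`; as `B` varies, it bounds `g` and `-g` almost everywhere on `A`.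
  have hb : ∀ B, MeasurableSet B → B ⊆ A → |∫ x in B, g x ∂μ| ≤ ∫ x in B, ‖φ‖ ∂μ := by
    intro B hB hBA
    have hμB : μ B ≠ ∞ := ne_top_of_le_ne_top hμA (measure_mono hBA)
    rw [hrep B hB hμB hBA, setIntegral_const, smul_eq_mul, mul_comm,
      ← norm_indicatorConstLp_one_one hB hμB]
    exact φ.le_opNorm _
  have hle : ∀ᵐ x ∂μ.restrict A, g x ≤ ‖φ‖ := by
    refine ae_le_of_forall_setIntegral_le hgA (integrable_const _) fun s hs _ => ?_
    rw [Measure.restrict_restrict hs]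
    exact (le_abs_self _).trans (hb _ (hs.inter hA) inter_subset_right)
  have hge : ∀ᵐ x ∂μ.restrict A, -g x ≤ ‖φ‖ := by
    refine ae_le_of_forall_setIntegral_le hgA.neg (integrable_const _) fun s hs _ => ?_
    rw [Measure.restrict_restrict hs]
    simp only [integral_neg]
    exact (neg_le_abs _).trans (hb _ (hs.inter hA) inter_subset_right)
  filter_upwards [(ae_restrict_iff' hA).1 hle, (ae_restrict_iff' hA).1 hge] with x h1 h2 hx
  exact abs_le'.2 ⟨h1 hx, h2 hx⟩

/-- In a measure space with the direct sum property, every continuous functional on `L¹` is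
represented by an element of `L^∞`. -/
theorem HasDirectSumProperty.exists_linfPairing_eq (hμ : HasDirectSumProperty μ)
    (φ : Lp ℝ 1 μ →L[ℝ] ℝ) : ∃ h : Lp ℝ ∞ μ, ‖h‖ ≤ ‖φ‖ ∧ linfPairing μ h = φ := by
  choose g hgm hgb hg using fun A : {A : Set Ω // MeasurableSet A ∧ μ A ≠ ∞} =>
    exists_setIntegral_eq_dual_l1 φ A.2.1 A.2.2
  have hint : ∀ A B : {A : Set Ω // MeasurableSet A ∧ μ A ≠ ∞},
      IntegrableOn (g A) (A.1 ∩ B.1) μ := by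
    intro A B
    have hm : MeasurableSet (A.1 ∩ B.1) := A.2.1.inter B.2.1
    refine Measure.integrableOn_of_bounded (M := ‖φ‖)
      (ne_top_of_le_ne_top A.2.2 (measure_mono inter_subset_left))
      (hgm A).aestronglyMeasurable ((ae_restrict_iff' hm).2 ?_)
    filter_upwards [hgb A] with x hx hx'
    exact hx hx'.1
  -- The family runs over all sets of finite measure; it is compatible because on `A ∩ B` both
  -- densities represent `φ`.
  obtain ⟨u, hu, hug⟩ := hμ.exists_measurable_ae_eq_restrict (A := fun A => A.1) (g := g)
    (fun A => A.2.1) hgm fun A B => by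
      have hm : MeasurableSet (A.1 ∩ B.1) := A.2.1.inter B.2.1
      have := Integrable.ae_eq_of_forall_setIntegral_eq _ _ (hint A B)
        (inter_comm B.1 A.1 ▸ hint B A) fun s hs _ => by
          have hms := hs.inter hm
          have hμs : μ (s ∩ (A.1 ∩ B.1)) ≠ ∞ := ne_top_of_le_ne_top A.2.2
            (measure_mono (inter_subset_right.trans inter_subset_left))
          rw [Measure.restrict_restrict hs,
            hg A _ hms hμs (inter_subset_right.trans inter_subset_left),
            hg B _ hms hμs (inter_subset_right.trans inter_subset_right)]
      filter_upwards [(ae_restrict_iff' hm).1 this] with x hx h1 h2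
      exact hx ⟨h1, h2⟩
  have hub : ∀ᵐ x ∂μ, |u x| ≤ ‖φ‖ := by
    refine hμ.semifinite.ae_of_forall_ae_restrict
      (measurableSet_le hu.abs measurable_const) fun A hA hμA => (ae_restrict_iff' hA).2 ?_
    filter_upwards [hug ⟨A, hA, hμA.ne⟩, hgb ⟨A, hA, hμA.ne⟩] with x h1 h2 hx
    rw [h1 hx]
    exact h2 hx
  have hmem : MemLp u ∞ μ := memLp_top_of_bound hu.aestronglyMeasurable _ hub
  refine ⟨hmem.toLp u, ?_, dual_l1_ext fun A hA hμA => ?_⟩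
  · rw [Lp.norm_toLp]
    exact ENNReal.toReal_le_of_le_ofReal (norm_nonneg _) (eLpNormEssSup_le_of_ae_bound hub)
  · rw [linfPairing_indicatorConstLp, ← hg ⟨A, hA, hμA⟩ A hA hμA subset_rfl]
    refine setIntegral_congr_ae hA ?_
    filter_upwards [hmem.coeFn_toLp, hug ⟨A, hA, hμA⟩] with x h1 h2 hx
    rw [h1, h2 hx]

theorem norm_linfPairing_le (h : Lp ℝ ∞ μ) : ‖linfPairing μ h‖ ≤ ‖h‖ := by
  refine ContinuousLinearMap.opNorm_le_bound _ (norm_nonneg _) fun f => ?_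
  rw [linfPairing_apply, L1.norm_eq_integral_norm, ← integral_const_mul]
  refine norm_integral_le_of_norm_le ((L1.integrable_coeFn f).norm.const_mul _) ?_
  have hb : ∀ᵐ x ∂μ, ‖h x‖ ≤ ‖h‖ := by
    filter_upwards [ae_le_eLpNormEssSup (f := h) (μ := μ)] with x hx
    rw [Lp.norm_def, ← toReal_enorm]
    exact ENNReal.toReal_mono (Lp.eLpNorm_ne_top h) (by simpa using hx)
  filter_upwards [hb] with x hx
  rw [norm_mul]
  exact mul_le_mul_of_nonneg_right hx (norm_nonneg _)

/-- The dual of `L¹` is `L^∞`, in a measure space with the direct sum property. -/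
noncomputable def HasDirectSumProperty.linfEquivDual (hμ : HasDirectSumProperty μ) :
    Lp ℝ ∞ μ ≃ₗ[ℝ] (Lp ℝ 1 μ →L[ℝ] ℝ) :=
  LinearEquiv.ofBijective (linfPairing μ).toLinearMap
    ⟨linfPairing_injective hμ.semifinite, fun φ => (hμ.exists_linfPairing_eq φ).imp fun _ h => h.2⟩

/-! ### Adjoints on `L^∞`. -/

/-- The adjoint, on `L^∞`, of a continuous operator of `L¹`. -/
noncomputable def HasDirectSumProperty.l1Adjoint (hμ : HasDirectSumProperty μ)
    (T : Lp ℝ 1 μ →L[ℝ] Lp ℝ 1 μ) : Lp ℝ ∞ μ →ₗ[ℝ] Lp ℝ ∞ μ where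
  toFun h := hμ.linfEquivDual.symm ((linfPairing μ h).comp T)
  map_add' h h' := by rw [map_add, ContinuousLinearMap.add_comp, map_add]
  map_smul' c h := by rw [map_smul, ContinuousLinearMap.smul_comp, map_smul]; rfl

theorem HasDirectSumProperty.linfPairing_l1Adjoint (hμ : HasDirectSumProperty μ)
    (T : Lp ℝ 1 μ →L[ℝ] Lp ℝ 1 μ) (h : Lp ℝ ∞ μ) (f : Lp ℝ 1 μ) :
    linfPairing μ (hμ.l1Adjoint T h) f = linfPairing μ h (T f) :=
  DFunLike.congr_fun (hμ.linfEquivDual.apply_symm_apply ((linfPairing μ h).comp T)) f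

/-- The representation theorem supplies a representative no larger than the functional, and by
injectivity it is the adjoint. -/
theorem HasDirectSumProperty.norm_l1Adjoint_le (hμ : HasDirectSumProperty μ)
    {T : Lp ℝ 1 μ →L[ℝ] Lp ℝ 1 μ} (hT : ‖T‖ ≤ 1) (h : Lp ℝ ∞ μ) :
    ‖hμ.l1Adjoint T h‖ ≤ ‖h‖ := by
  obtain ⟨k, hk, hk'⟩ := hμ.exists_linfPairing_eq ((linfPairing μ h).comp T)
  have : hμ.l1Adjoint T h = k := linfPairing_injective hμ.semifinite <| by
    ext f
    rw [hμ.linfPairing_l1Adjoint, hk']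
    rfl
  rw [this]
  calc ‖k‖ ≤ ‖linfPairing μ h‖ * ‖T‖ := hk.trans (ContinuousLinearMap.opNorm_comp_le _ _)
    _ ≤ ‖h‖ * 1 := mul_le_mul (norm_linfPairing_le h) hT (norm_nonneg _) (norm_nonneg _)
    _ = ‖h‖ := mul_one _

theorem continuous_linfPairing_sigmaTopology (g : Lp ℝ 1 μ) :
    Continuous[sigmaTopology μ, _] fun h : Lp ℝ ∞ μ => linfPairing μ h g := by
  simp only [linfPairing_apply]
  exact @Continuous.comp (Lp ℝ ∞ μ) (Lp ℝ 1 μ → ℝ) ℝ (sigmaTopology μ) Pi.topologicalSpace _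
    (fun h k => ∫ x, h x * k x ∂μ) (fun p => p g) (continuous_apply g) continuous_induced_dom

/-- Pairing the image with `g` is pairing the argument with `T g`, which is again one of the
functionals defining the topology. -/
theorem HasDirectSumProperty.continuous_l1Adjoint (hμ : HasDirectSumProperty μ)
    (T : Lp ℝ 1 μ →L[ℝ] Lp ℝ 1 μ) :
    Continuous[sigmaTopology μ, sigmaTopology μ] (hμ.l1Adjoint T) := by
  let := sigmaTopology μ
  refine continuous_induced_rng.2 (continuous_pi fun g => ?_)
  change Continuous[sigmaTopology μ, _] (fun f : Lp ℝ ∞ μ => ∫ x, hμ.l1Adjoint T f x * g x ∂μ)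
  simp only [← linfPairing_apply, hμ.linfPairing_l1Adjoint]
  exact continuous_linfPairing_sigmaTopology (T g)

/-- The adjoint of an operator of `L¹` that contracts the `L^∞` norm contracts the `L¹` norm. -/
theorem HasDirectSumProperty.eLpNorm_one_l1Adjoint_le (hμ : HasDirectSumProperty μ)
    {T : Lp ℝ 1 μ →L[ℝ] Lp ℝ 1 μ} (hT : ∀ f : Lp ℝ 1 μ, (f : Ω →ₘ[μ] ℝ) ∈ Lp ℝ ∞ μ →
      eLpNorm (T f) ∞ μ ≤ eLpNorm f ∞ μ) (g : Lp ℝ ∞ μ) :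
    eLpNorm (hμ.l1Adjoint T g) 1 μ ≤ eLpNorm g 1 μ := by
  set k := hμ.l1Adjoint T g
  have hk := Lp.aestronglyMeasurable k
  have hum := hk.stronglyMeasurable_mk.measurable
  set u : Ω → ℝ := hk.mk k
  rw [eLpNorm_congr_ae hk.ae_eq_mk, eLpNorm_one_eq_lintegral_enorm, eLpNorm_one_eq_lintegral_enorm]
  refine hμ.semifinite.lintegral_le_of_forall_setLIntegral_le hum.enorm fun A hA hμA => ?_
  classical
  -- The sign of `u` on `A` is a test function in `L¹ ∩ L^∞` with `‖s‖_∞ ≤ 1`, so `∫_A |u| = ∫ g T s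
  -- ≤ ‖g‖₁`.
  set s : Ω → ℝ := A.indicator fun x => if 0 ≤ u x then 1 else -1
  have hsm : Measurable s :=
    (Measurable.ite (measurableSet_le measurable_const hum) measurable_const
      measurable_const).indicator hA
  have hs1 : ∀ x, ‖s x‖ ≤ 1 := fun x => by
    by_cases hx : x ∈ A <;> by_cases hu : 0 ≤ u x <;> simp [s, hx, hu]
  have hsLinf : MemLp s ∞ μ := memLp_top_of_bound hsm.aestronglyMeasurable 1 (ae_of_all _ hs1)
  have hsint : Integrable s μ := by
    refine (integrable_indicator_iff hA).2 (Measure.integrableOn_of_bounded (M := 1) hμA.ne ?_ ?_)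
    · exact (Measurable.ite (measurableSet_le measurable_const hum) measurable_const
        measurable_const).aestronglyMeasurable
    · refine ae_of_all _ fun x => ?_
      by_cases hu : 0 ≤ u x <;> simp [hu]
  set f : Lp ℝ 1 μ := (memLp_one_iff_integrable.2 hsint).toLp s
  have hfs : f =ᵐ[μ] s := MemLp.coeFn_toLp _
  have hTf : ∀ᵐ x ∂μ, ‖T f x‖ₑ ≤ 1 := by
    have h1 : eLpNorm (T f) ∞ μ ≤ 1 := by
      refine (hT f ?_).trans ?_
      · rw [Lp.mem_Lp_iff_memLp]
        exact (memLp_congr_ae hfs).2 hsLinf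
      · rw [eLpNorm_congr_ae hfs, eLpNorm_exponent_top]
        simpa using eLpNormEssSup_le_of_ae_bound (μ := μ) (ae_of_all _ hs1)
    filter_upwards [ae_le_eLpNormEssSup (f := T f) (μ := μ)] with x hx
    exact hx.trans (by simpa using h1)
  have hint : IntegrableOn u A μ :=
    (integrableOn_of_linf k hμA).congr (ae_restrict_of_ae hk.ae_eq_mk)
  have h1 : ∫ x in A, ‖u x‖ ∂μ = linfPairing μ k f := by
    rw [linfPairing_apply, ← integral_indicator hA]
    refine integral_congr_ae ?_
    filter_upwards [hk.ae_eq_mk, hfs] with x h1 h2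
    rw [h1, h2]
    by_cases hx : x ∈ A
    · by_cases hu : 0 ≤ u x
      · simp [s, hx, hu, u, abs_of_nonneg hu]
      · simp [s, hx, hu, u, abs_of_neg (not_le.1 hu)]
    · simp [s, hx]
  calc ∫⁻ x in A, ‖u x‖ₑ ∂μ = ENNReal.ofReal (linfPairing μ k f) := by
        rw [← h1, ofReal_integral_norm_eq_lintegral_enorm hint]
    _ ≤ ‖∫ x, g x * T f x ∂μ‖ₑ := by
        rw [hμ.linfPairing_l1Adjoint, linfPairing_apply]
        exact Real.ofReal_le_enorm _
    _ ≤ ∫⁻ x, ‖g x * T f x‖ₑ ∂μ := enorm_integral_le_lintegral_enorm _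
    _ ≤ ∫⁻ x, ‖g x‖ₑ ∂μ := lintegral_mono_ae <| by
        filter_upwards [hTf] with x hx
        rw [enorm_mul]
        exact mul_le_of_le_one_right' hx

/-! ### Extension to `L¹` and the second adjoint. -/

/-- The bounded elements of `L¹`. -/
def boundedL1 (μ : Measure Ω) : Submodule ℝ (Lp ℝ 1 μ) where
  carrier := {f | (f : Ω →ₘ[μ] ℝ) ∈ Lp ℝ ∞ μ}
  add_mem' hf hg := (Lp ℝ ∞ μ).add_mem hf hg
  zero_mem' := (Lp ℝ ∞ μ).zero_mem
  smul_mem' c _ hf := (Lp.LpSubmodule ℝ ℝ ∞ μ).smul_mem c hf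

/-- Integrable simple functions are bounded and already dense. -/
theorem denseRange_boundedL1 : DenseRange (boundedL1 μ).subtypeL := by
  refine (Lp.simpleFunc.denseRange (E := ℝ) (p := 1) (μ := μ) ENNReal.one_ne_top).mono ?_
  rintro _ ⟨f, rfl⟩
  refine ⟨⟨f.1, ?_⟩, rfl⟩
  change (f.1 : Ω →ₘ[μ] ℝ) ∈ Lp ℝ ∞ μ
  rw [Lp.mem_Lp_iff_memLp]
  refine (memLp_congr_ae (Lp.simpleFunc.toSimpleFunc_eq_toFun f)).1 ?_
  exact SimpleFunc.memLp_top _ _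

/-- The restriction to `L¹ ∩ L^∞` of the adjoint of an absolute contraction of `L¹` extends to a
contraction of `L¹`. -/
theorem HasDirectSumProperty.exists_extension_l1Adjoint (hμ : HasDirectSumProperty μ)
    {T : Lp ℝ 1 μ →L[ℝ] Lp ℝ 1 μ} (hT : ∀ f : Lp ℝ 1 μ, (f : Ω →ₘ[μ] ℝ) ∈ Lp ℝ ∞ μ →
      eLpNorm (T f) ∞ μ ≤ eLpNorm f ∞ μ) :
    ∃ T' : Lp ℝ 1 μ →L[ℝ] Lp ℝ 1 μ, ‖T'‖ ≤ 1 ∧ ∀ (f : Lp ℝ 1 μ) (g : Lp ℝ ∞ μ),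
      (f : Ω →ₘ[μ] ℝ) = g → (T' f : Ω →ₘ[μ] ℝ) = hμ.l1Adjoint T g := by
  have hle := hμ.eLpNorm_one_l1Adjoint_le hT
  let T₀ : boundedL1 μ →ₗ[ℝ] Lp ℝ 1 μ :=
    { toFun := fun f => ⟨hμ.l1Adjoint T ⟨f.1.1, f.2⟩, Lp.mem_Lp_iff_eLpNorm_lt_top.2
        ((hle ⟨f.1.1, f.2⟩).trans_lt (Lp.eLpNorm_lt_top f.1))⟩
      map_add' := fun f f' => by
        have h := congrArg Subtype.val
          (map_add (hμ.l1Adjoint T) ⟨f.1.1, f.2⟩ ⟨f'.1.1, f'.2⟩)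
        exact Subtype.ext h
      map_smul' := fun c f => by
        have h := congrArg Subtype.val (map_smul (hμ.l1Adjoint T) c ⟨f.1.1, f.2⟩)
        exact Subtype.ext h }
  let T₁ : boundedL1 μ →L[ℝ] Lp ℝ 1 μ := T₀.mkContinuous 1 fun f => by
    rw [one_mul, Submodule.coe_norm, Lp.norm_def, Lp.norm_def]
    exact ENNReal.toReal_mono (Lp.eLpNorm_ne_top f.1) (hle ⟨f.1.1, f.2⟩)
  refine ⟨T₁.extend (boundedL1 μ).subtypeL, ?_, fun f g hfg => ?_⟩
  · refine (T₁.opNorm_extend_le (N := 1) denseRange_boundedL1 fun f => by simp).trans ?_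
    simpa using T₀.mkContinuous_norm_le zero_le_one _
  · have hf : f ∈ boundedL1 μ := by
      change (f : Ω →ₘ[μ] ℝ) ∈ Lp ℝ ∞ μ
      rw [hfg]
      exact g.2
    have := T₁.extend_eq (e := (boundedL1 μ).subtypeL) denseRange_boundedL1
      (isUniformEmbedding_subtype_val.isUniformInducing) ⟨f, hf⟩
    have hg : (⟨f.1, hf⟩ : Lp ℝ ∞ μ) = g := Subtype.ext hfg
    rw [← hg]
    exact congrArg Subtype.val this

/-- The second adjoint of an absolute contraction of `L¹` agrees with it on `L¹ ∩ L^∞`. -/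
theorem HasDirectSumProperty.l1Adjoint_extension_eq (hμ : HasDirectSumProperty μ)
    {T T' : Lp ℝ 1 μ →L[ℝ] Lp ℝ 1 μ} (h' : ∀ (f : Lp ℝ 1 μ) (g : Lp ℝ ∞ μ),
      (f : Ω →ₘ[μ] ℝ) = g → (T' f : Ω →ₘ[μ] ℝ) = hμ.l1Adjoint T g)
    {f : Lp ℝ 1 μ} {h : Lp ℝ ∞ μ} (hfh : (f : Ω →ₘ[μ] ℝ) = h) :
    (hμ.l1Adjoint T' h : Ω →ₘ[μ] ℝ) = T f := by
  refine AEEqFun.ext <| hμ.semifinite.ae_eq_of_forall_setIntegral_eq (Lp.aestronglyMeasurable _)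
    (Lp.aestronglyMeasurable _) (fun _ _ hA => integrableOn_of_linf _ hA)
    (fun _ _ _ => (L1.integrable_coeFn (T f)).integrableOn) fun A hA hμA => ?_
  -- `χ` and `χ'` are the same class seen in `L¹` and in `L^∞`, so `T' χ` is the adjoint of `T` at
  -- `χ'`.
  set χ : Lp ℝ 1 μ := indicatorConstLp 1 hA hμA.ne 1
  set χ' : Lp ℝ ∞ μ := indicatorConstLp ∞ hA hμA.ne 1
  have hχ := h' χ χ' rfl
  have hmul : ∀ k : Lp ℝ 1 μ, linfPairing μ χ' k = ∫ x in A, k x ∂μ := fun k => by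
    rw [linfPairing_apply, ← integral_indicator hA]
    refine integral_congr_ae ?_
    filter_upwards [indicatorConstLp_coeFn (p := ∞) (hs := hA) (hμs := hμA.ne) (c := (1 : ℝ))]
      with x hx
    rw [hx]
    by_cases hxA : x ∈ A <;> simp [hxA]
  rw [← linfPairing_indicatorConstLp _ hA hμA.ne, hμ.linfPairing_l1Adjoint, ← hmul,
    ← hμ.linfPairing_l1Adjoint T χ' f, linfPairing_apply, linfPairing_apply]
  change ∫ x, (h : Ω →ₘ[μ] ℝ) x * (T' χ : Ω →ₘ[μ] ℝ) x ∂μ =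
    ∫ x, (hμ.l1Adjoint T χ' : Ω →ₘ[μ] ℝ) x * (f : Ω →ₘ[μ] ℝ) x ∂μ
  rw [hχ, hfh]
  simp only [mul_comm]

/-! ### Density of `L¹ ∩ L^∞` in `σ(L^∞, L¹)`. -/

/-- The integral of an integrable function is approximated by its integrals over the large sets of
finite measure. -/
theorem MeasureTheory.Integrable.exists_forall_dist_setIntegral_lt {u : Ω → ℝ}
    (hu : Integrable u μ) {ε : ℝ} (hε : 0 < ε) : ∃ A₀, MeasurableSet A₀ ∧ μ A₀ < ∞ ∧
      ∀ A, MeasurableSet A → A₀ ⊆ A → dist (∫ x in A, u x ∂μ) (∫ x, u x ∂μ) < ε := by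
  obtain ⟨A₀, hA₀, hμA₀, hlt⟩ := (memLp_one_iff_integrable.2 hu).exists_eLpNorm_indicator_compl_lt
    ENNReal.one_ne_top (ENNReal.ofReal_pos.2 hε).ne'
  refine ⟨A₀, hA₀, hμA₀, fun A hA hA₀A => ?_⟩
  rw [dist_comm, Real.dist_eq, ← integral_add_compl hA hu, add_sub_cancel_left,
    ← ENNReal.ofReal_lt_ofReal_iff hε, ← Real.enorm_eq_ofReal_abs]
  refine (enorm_integral_le_lintegral_enorm _).trans_lt ((lintegral_mono_set
    (compl_subset_compl.2 hA₀A)).trans_lt ?_)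
  rwa [eLpNorm_one_eq_lintegral_enorm,
    lintegral_congr (fun x => enorm_indicator_eq_indicator_enorm _ _),
    lintegral_indicator hA₀.compl] at hlt

/-- Operators of `L^∞` that are continuous for `σ(L^∞, L¹)` and agree on `L¹ ∩ L^∞` are equal. -/
theorem eq_of_continuous_sigmaTopology (hμ : IsSemifiniteMeasure μ) {R R' : Lp ℝ ∞ μ → Lp ℝ ∞ μ}
    (hR : Continuous[sigmaTopology μ, sigmaTopology μ] R)
    (hR' : Continuous[sigmaTopology μ, sigmaTopology μ] R')
    (h : ∀ f : Lp ℝ ∞ μ, (f : Ω →ₘ[μ] ℝ) ∈ Lp ℝ 1 μ → R f = R' f) : R = R' := by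
  funext f
  refine linfPairing_injective hμ (ContinuousLinearMap.ext fun g => ?_)
  -- A net indexed by all sets of finite measure replaces a sequence, since `μ` need not be
  -- σ-finite.
  let ι := {A : Set Ω // MeasurableSet A ∧ μ A < ∞}
  have : Nonempty ι := ⟨⟨∅, MeasurableSet.empty, by simp⟩⟩
  have : IsDirectedOrder ι := ⟨fun A B => ⟨⟨A.1 ∪ B.1, A.2.1.union B.2.1,
    measure_union_lt_top A.2.2 B.2.2⟩, subset_union_left, subset_union_right⟩⟩
  let F : ι → Lp ℝ ∞ μ := fun A => ((Lp.memLp f).indicator A.2.1).toLp _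
  have hF : ∀ A, (F A : Ω → ℝ) =ᵐ[μ] A.1.indicator f := fun A => MemLp.coeFn_toLp _
  have hF1 : ∀ A, (F A : Ω →ₘ[μ] ℝ) ∈ Lp ℝ 1 μ := fun A => by
    rw [Lp.mem_Lp_iff_memLp]
    refine (memLp_congr_ae (hF A)).2 (memLp_one_iff_integrable.2 ?_)
    exact (integrable_indicator_iff A.2.1).2 (integrableOn_of_linf f A.2.2)
  have hlim : Filter.Tendsto F Filter.atTop (@nhds _ (sigmaTopology μ) f) := by
    rw [nhds_induced, Filter.tendsto_comap_iff, tendsto_pi_nhds]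
    intro k
    change Filter.Tendsto (fun A : ι => ∫ x, F A x * k x ∂μ) Filter.atTop (𝓝 (∫ x, f x * k x ∂μ))
    have hint : Integrable (fun x => f x * k x) μ :=
      memLp_one_iff_integrable.1
        ((ContinuousLinearMap.mul ℝ ℝ).memLp_of_bilin 1 (Lp.memLp f) (Lp.memLp k))
    have hval : ∀ A : ι, ∫ x, F A x * k x ∂μ = ∫ x in A.1, f x * k x ∂μ := fun A => by
      rw [← integral_indicator A.2.1]
      refine integral_congr_ae ?_
      filter_upwards [hF A] with x hx
      rw [hx]
      by_cases hxA : x ∈ A.1 <;> simp [hxA]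
    simp only [hval]
    refine Metric.tendsto_nhds.2 fun ε hε => ?_
    obtain ⟨A₀, hA₀, hμA₀, hlt⟩ := hint.exists_forall_dist_setIntegral_lt hε
    filter_upwards [Filter.eventually_ge_atTop (⟨A₀, hA₀, hμA₀⟩ : ι)] with A hA
    exact hlt A.1 A.2.1 hA
  have heval : ∀ Q : Lp ℝ ∞ μ → Lp ℝ ∞ μ, Continuous[sigmaTopology μ, sigmaTopology μ] Q →
      Filter.Tendsto (fun A => linfPairing μ (Q (F A)) g) Filter.atTop
        (𝓝 (linfPairing μ (Q f) g)) := fun Q hQ => by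
    exact ((@Continuous.tendsto _ _ (sigmaTopology μ) _ _
      (continuous_linfPairing_sigmaTopology g) _).comp
      (@Continuous.tendsto _ _ (sigmaTopology μ) (sigmaTopology μ) _ hQ f)).comp hlim
  have h2 := heval R' hR'
  simp only [← h _ (hF1 _)] at h2
  exact tendsto_nhds_unique (heval R hR) h2

/-! ### Operators of `L¹ + L^∞`. -/

theorem L1AddLinf.exists_add_eq (x : L1AddLinf μ) :
    ∃ (f : Lp ℝ 1 μ) (h : Lp ℝ ∞ μ), inclL1 f + inclLinf h = x := by
  obtain ⟨f, hf, h, hh, hfh⟩ := Submodule.mem_sup.1 x.2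
  exact ⟨⟨f, hf⟩, ⟨h, hh⟩, Subtype.ext hfh⟩

/-- Operators of `L¹` and `L^∞` that agree on `L¹ ∩ L^∞` come from one operator of
`L¹ + L^∞`. -/
theorem L1AddLinf.exists_linearMap (T : Lp ℝ 1 μ →ₗ[ℝ] Lp ℝ 1 μ) (R : Lp ℝ ∞ μ →ₗ[ℝ] Lp ℝ ∞ μ)
    (h : ∀ (f : Lp ℝ 1 μ) (g : Lp ℝ ∞ μ), (f : Ω →ₘ[μ] ℝ) = g →
      (T f : Ω →ₘ[μ] ℝ) = R g) :
    ∃ S : L1AddLinf μ →ₗ[ℝ] L1AddLinf μ,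
      (∀ f, S (inclL1 f) = inclL1 (T f)) ∧ ∀ g, S (inclLinf g) = inclLinf (R g) := by
  let P : (Ω →ₘ[μ] ℝ) →ₗ.[ℝ] L1AddLinf μ := ⟨Lp.LpSubmodule ℝ ℝ 1 μ,
    { toFun := fun f => inclL1 (T ⟨f.1, f.2⟩)
      map_add' := fun f f' => by
        have h := congrArg Subtype.val (map_add T ⟨f.1, f.2⟩ ⟨f'.1, f'.2⟩)
        exact Subtype.ext h
      map_smul' := fun c f => by
        have h := congrArg Subtype.val (map_smul T c ⟨f.1, f.2⟩)
        exact Subtype.ext h }⟩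
  let Q : (Ω →ₘ[μ] ℝ) →ₗ.[ℝ] L1AddLinf μ := ⟨Lp.LpSubmodule ℝ ℝ ∞ μ,
    { toFun := fun f => inclLinf (R ⟨f.1, f.2⟩)
      map_add' := fun f f' => by
        have h := congrArg Subtype.val (map_add R ⟨f.1, f.2⟩ ⟨f'.1, f'.2⟩)
        exact Subtype.ext h
      map_smul' := fun c f => by
        have h := congrArg Subtype.val (map_smul R c ⟨f.1, f.2⟩)
        exact Subtype.ext h }⟩
  have H : ∀ (x : P.domain) (y : Q.domain), (x : Ω →ₘ[μ] ℝ) = y → P x = Q y :=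
    fun x y hxy => Subtype.ext (h ⟨x.1, x.2⟩ ⟨y.1, y.2⟩ hxy)
  -- The domain of `P.sup Q H` is the sum of the two domains, which is `L1AddLinf μ` by definition.
  refine ⟨(P.sup Q H).toFun, fun f => ?_, fun g => ?_⟩
  · exact ((P.left_le_sup Q H).2 (x := ⟨f.1, f.2⟩) (y := inclL1 f) rfl).symm
  · exact ((P.right_le_sup Q H).2 (x := ⟨g.1, g.2⟩) (y := inclLinf g) rfl).symm

end

theorem theoremt31 {Ω : Type*} [MeasurableSpace Ω] (μ : Measure Ω) [μ.IsComplete]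
    (hμ : HasDirectSumProperty μ)
    (T : Lp ℝ 1 μ →ₗ[ℝ] Lp ℝ 1 μ) (hT : IsAbsoluteContraction T) :
    ∃! S : L1AddLinf μ →ₗ[ℝ] L1AddLinf μ,
      IsDunfordSchwartz S ∧ (∀ f : Lp ℝ 1 μ, S (inclL1 f) = inclL1 (T f)) ∧
        IsSigmaContinuousOnLinf S := by
  let T₁ : Lp ℝ 1 μ →L[ℝ] Lp ℝ 1 μ := T.mkContinuous 1 fun f => by
    rw [one_mul]
    exact hT.norm_one_le f
  obtain ⟨T', hT', h'⟩ := hμ.exists_extension_l1Adjoint (T := T₁) hT.norm_top_le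
  obtain ⟨S, hS1, hS2⟩ := L1AddLinf.exists_linearMap T (hμ.l1Adjoint T') fun f g hfg =>
    (hμ.l1Adjoint_extension_eq h' hfg).symm
  refine ⟨S, ⟨⟨fun f => ?_, fun f => ?_⟩, hS1, hμ.l1Adjoint T', hS2,
    hμ.continuous_l1Adjoint T'⟩, ?_⟩
  · rw [hS1]
    exact (ENNReal.toReal_le_toReal (Lp.eLpNorm_ne_top _) (Lp.eLpNorm_ne_top _)).1
      (hT.norm_one_le f)
  · rw [hS2]
    exact (ENNReal.toReal_le_toReal (Lp.eLpNorm_ne_top _) (Lp.eLpNorm_ne_top _)).1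
      (hμ.norm_l1Adjoint_le hT' f)
  · rintro S' ⟨-, hS1', R, hR, hRc⟩
    -- On `L¹ ∩ L^∞` both maps are dictated by `T`, through `S'` and `S` respectively.
    have hRR : R = hμ.l1Adjoint T' :=
      eq_of_continuous_sigmaTopology hμ.semifinite hRc (hμ.continuous_l1Adjoint T') fun f hf => by
        have h1 : inclLinf f = inclL1 (⟨f.1, hf⟩ : Lp ℝ 1 μ) := rfl
        have h2 : inclLinf (R f) = inclLinf (hμ.l1Adjoint T' f) := by
          rw [← hR, ← hS2, h1, hS1, hS1']
        have h3 := congrArg Subtype.val h2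
        exact Subtype.ext h3
    refine LinearMap.ext fun x => ?_
    obtain ⟨f, h, rfl⟩ := L1AddLinf.exists_add_eq x
    rw [map_add, map_add, hS1, hS1', hR, hS2, hRR]
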